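/- Let $R$ be a commutative ring with identity. A finitely generated ideal $J$ of $R$ is called a GV-ideal if $\mathrm{Hom}_R(R/J,R)=\mathrm{Ext}^1_R(R/J,R)=0$; let $\mathrm{GV}(R)$ be the set of GV-ideals of $R$. For an $R$-module $M$ put $\mathrm{tor}_{\mathrm{GV}}(M)=\{x\in M : Jx=0 \text{ for some } J\in\mathrm{GV}(R)\}$; $M$ is GV-torsion if $\mathrm{tor}_{\mathrm{GV}}(M)=M$, and GV-torsion-free if $\mathrm{tor}_{\mathrm{GV}}(M)=0$. A $w$-module is a GV-torsion-free $R$-module $M$ with $\mathrm{Ext}^1_R(R/J,M)=0$ for all $J\in\mathrm{GV}(R)$. A strong $w$-module is a $w$-module $M$ such that $\mathrm{Ext}^i_R(T,M)=0$ for every integer $i\ge 2$ and every GV-torsion $R$-module $T$. The ring $R$ is a DW-ring if $\mathrm{GV}(R)=\{R\}$. Then every $w$-module over $R$ is a strong $w$-module if and only if $R$ is a DW-ring. -/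

import Mathlib

open CategoryTheory

universe u

namespace GV

/-- The assertion `Ext_R^i(N, M) = 0`. -/
def ExtVanishes (R : Type u) [CommRing R] (i : ℕ)
    (N : Type u) [AddCommGroup N] [Module R N]
    (M : Type u) [AddCommGroup M] [Module R M] : Prop :=
  Subsingleton (Abelian.Ext (ModuleCat.of R N) (ModuleCat.of R M) i)

/-- `J` is a GV-ideal: it is finitely generated and
`Hom_R(R/J, R) = Ext_R^1(R/J, R) = 0`. -/
structure IsGVIdeal {R : Type u} [CommRing R] (J : Ideal R) : Prop where
  fg : J.FG
  hom_eq_zero : ∀ f : (R ⧸ J) →ₗ[R] R, f = 0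
  ext_one : ExtVanishes R 1 (R ⧸ J) R

/-- `GV(R)`, the set of all GV-ideals of `R`. -/
def gvIdeals (R : Type u) [CommRing R] : Set (Ideal R) :=
  {J | IsGVIdeal J}

/-- The underlying set of `tor_GV(M)`: the elements annihilated by some GV-ideal. -/
def gvTorsion (R : Type u) [CommRing R] (M : Type u) [AddCommGroup M] [Module R M] : Set M :=
  {x | ∃ J ∈ gvIdeals R, ∀ a ∈ J, a • x = 0}

/-- `M` is GV-torsion: `tor_GV(M) = M`. -/
def IsGVTorsion (R : Type u) [CommRing R] (M : Type u) [AddCommGroup M] [Module R M] : Prop :=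
  gvTorsion R M = Set.univ

/-- `M` is GV-torsion-free: `tor_GV(M) = 0`. -/
def IsGVTorsionFree (R : Type u) [CommRing R]
    (M : Type u) [AddCommGroup M] [Module R M] : Prop :=
  gvTorsion R M = {0}

/-- `M` is a `w`-module: it is GV-torsion-free and `Ext_R^1(R/J, M) = 0` for all `J ∈ GV(R)`. -/
structure IsWModule (R : Type u) [CommRing R]
    (M : Type u) [AddCommGroup M] [Module R M] : Prop where
  torsionFree : IsGVTorsionFree R M
  ext_one : ∀ J ∈ gvIdeals R, ExtVanishes R 1 (R ⧸ J) M

/-- `M` is a strong `w`-module: it is a `w`-module and `Ext_R^i(T, M) = 0` for all `i ≥ 2` and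
all GV-torsion modules `T`. -/
structure IsStrongWModule (R : Type u) [CommRing R]
    (M : Type u) [AddCommGroup M] [Module R M] : Prop extends IsWModule R M where
  ext_ge_two : ∀ i : ℕ, 2 ≤ i → ∀ (T : Type u) [AddCommGroup T] [Module R T],
    IsGVTorsion R T → ExtVanishes R i T M

/-- `R` is a DW-ring: `GV(R) = {R}`. -/
def IsDWRing (R : Type u) [CommRing R] : Prop :=
  gvIdeals R = {⊤}

end GV

section

open Abelian

variable {R : Type u} [CommRing R]

namespace GV

/-! For a GV-ideal `J`, take `0 → K → R^n → J → 0`. Since `R^n` is a `w`-module and `J ⊆ R` is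
GV-torsion-free, `K` is a `w`-module. If `K` is strong, `Ext^2(R/J, K) = 0`, which forces
`Ext^1(R/J, J) = 0`; then every endomorphism of `R/J` lifts to a map `R/J → R`, hence is zero, and
`J = R`. Conversely, over a DW-ring every GV-torsion module is zero. -/

theorem subsingleton_ext_X₁ {X : ModuleCat.{u} R} {S : ShortComplex (ModuleCat.{u} R)}
    (hS : S.ShortExact) {m n : ℕ} (h : m + 1 = n)
    (h₃ : Subsingleton (Ext X S.X₃ m)) (h₂ : Subsingleton (Ext X S.X₂ n)) :
    Subsingleton (Ext X S.X₁ n) := by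
  refine subsingleton_of_forall_eq 0 fun x ↦ ?_
  obtain ⟨y, rfl⟩ := Ext.covariant_sequence_exact₁ X hS x (Subsingleton.elim _ _) h
  rw [Subsingleton.elim y 0, Ext.zero_comp]

theorem subsingleton_ext_X₃ {X : ModuleCat.{u} R} {S : ShortComplex (ModuleCat.{u} R)}
    (hS : S.ShortExact) {m n : ℕ} (h : m + 1 = n)
    (h₂ : Subsingleton (Ext X S.X₂ m)) (h₁ : Subsingleton (Ext X S.X₁ n)) :
    Subsingleton (Ext X S.X₃ m) := by
  refine subsingleton_of_forall_eq 0 fun x ↦ ?_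
  obtain ⟨y, rfl⟩ := Ext.covariant_sequence_exact₃ X hS x h (Subsingleton.elim _ _)
  rw [Subsingleton.elim y 0, Ext.zero_comp]

theorem extVanishes_of_subsingleton_left (i : ℕ) (N : Type u) [AddCommGroup N] [Module R N]
    [Subsingleton N] (M : Type u) [AddCommGroup M] [Module R M] : ExtVanishes R i N M := by
  refine subsingleton_of_forall_eq 0 fun x ↦ ?_
  rw [← Ext.mk₀_id_comp x,
    (ModuleCat.isZero_of_subsingleton (ModuleCat.of R N)).eq_of_src (𝟙 _) 0,
    Ext.mk₀_zero, Ext.zero_comp]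

theorem extVanishes_zero_of_linearMap_eq_zero {N M : Type u} [AddCommGroup N] [Module R N]
    [AddCommGroup M] [Module R M] (h : ∀ f : N →ₗ[R] M, f = 0) : ExtVanishes R 0 N M := by
  refine subsingleton_of_forall_eq 0 fun x ↦ ?_
  obtain ⟨f, rfl⟩ := (Ext.mk₀_bijective _ _).2 x
  rw [show f = 0 from ModuleCat.hom_ext (h f.hom), Ext.mk₀_zero]

theorem ExtVanishes.pi {i : ℕ} {N M : Type u} [AddCommGroup N] [Module R N]
    [AddCommGroup M] [Module R M] (h : ExtVanishes R i N M) (n : ℕ) :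
    ExtVanishes R i N (Fin n → M) := by
  have : Subsingleton (Ext (ModuleCat.of R N) (ModuleCat.of R M) i) := h
  refine subsingleton_of_forall_eq 0 fun x ↦ ?_
  let p (k : Fin n) : ModuleCat.of R (Fin n → M) ⟶ ModuleCat.of R M :=
    ModuleCat.ofHom (LinearMap.proj k)
  let s (k : Fin n) : ModuleCat.of R M ⟶ ModuleCat.of R (Fin n → M) :=
    ModuleCat.ofHom (LinearMap.single R (fun _ ↦ M) k)
  -- Splitting the identity of `M^n` makes any class a sum of classes factoring through `Ext^i(N, M)
  -- = 0`.
  have hid : 𝟙 (ModuleCat.of R (Fin n → M)) = ∑ k, p k ≫ s k := by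
    apply ModuleCat.hom_ext
    rw [ModuleCat.hom_sum]
    ext v
    simp [p, s, Finset.sum_apply, Pi.single_apply]
  rw [← Ext.comp_mk₀_id x, hid, Ext.mk₀_sum, Ext.comp_sum]
  refine Finset.sum_eq_zero fun k _ ↦ ?_
  rw [← Ext.mk₀_comp_mk₀, ← Ext.comp_assoc_of_third_deg_zero,
    Subsingleton.elim (x.comp (Ext.mk₀ (p k)) (add_zero i)) 0, Ext.zero_comp]

theorem isGVIdeal_top : IsGVIdeal (⊤ : Ideal R) where
  fg := ⟨{1}, by simp⟩
  hom_eq_zero f := by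
    have : Subsingleton (R ⧸ (⊤ : Ideal R)) := Ideal.Quotient.subsingleton_iff.2 rfl
    exact LinearMap.ext fun x ↦ by rw [Subsingleton.elim x 0, map_zero, map_zero]
  ext_one := by
    have : Subsingleton (R ⧸ (⊤ : Ideal R)) := Ideal.Quotient.subsingleton_iff.2 rfl
    exact extVanishes_of_subsingleton_left 1 _ R

theorem isGVTorsionFree_iff {M : Type u} [AddCommGroup M] [Module R M] :
    IsGVTorsionFree R M ↔
      ∀ J : Ideal R, IsGVIdeal J → ∀ x : M, (∀ a ∈ J, a • x = 0) → x = 0 := by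
  constructor
  · intro h J hJ x hx
    have hmem : x ∈ gvTorsion R M := ⟨J, hJ, hx⟩
    rwa [h] at hmem
  · intro h
    refine Set.eq_singleton_iff_unique_mem.2 ⟨⟨⊤, isGVIdeal_top, fun a _ ↦ smul_zero a⟩, ?_⟩
    rintro x ⟨J, hJ, hx⟩
    exact h J hJ x hx

theorem isGVTorsionFree_self : IsGVTorsionFree R R := by
  refine isGVTorsionFree_iff.2 fun J hJ x hx ↦ ?_
  -- As `J` kills `x`, there is a map `R/J → R` sending `1` to `x`.
  have h : (1 : R) • x = 0 := LinearMap.congr_fun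
    (hJ.hom_eq_zero (J.liftQ (LinearMap.toSpanSingleton R R x) fun a ha ↦ hx a ha))
    (Submodule.Quotient.mk 1)
  rwa [one_smul] at h

theorem IsGVTorsionFree.of_injective {M N : Type u} [AddCommGroup M] [Module R M]
    [AddCommGroup N] [Module R N] (hN : IsGVTorsionFree R N) (f : M →ₗ[R] N)
    (hf : Function.Injective f) : IsGVTorsionFree R M := by
  refine isGVTorsionFree_iff.2 fun J hJ x hx ↦ hf ?_
  rw [map_zero]
  exact isGVTorsionFree_iff.1 hN J hJ _ fun a ha ↦ by rw [← map_smul, hx a ha, map_zero]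

theorem IsGVTorsionFree.pi {M : Type u} [AddCommGroup M] [Module R M]
    (hM : IsGVTorsionFree R M) (n : ℕ) : IsGVTorsionFree R (Fin n → M) :=
  isGVTorsionFree_iff.2 fun J hJ _ hx ↦ funext fun k ↦
    isGVTorsionFree_iff.1 hM J hJ _ fun a ha ↦ congrFun (hx a ha) k

theorem smul_quotient_eq_zero {J : Ideal R} {a : R} (ha : a ∈ J) (x : R ⧸ J) : a • x = 0 := by
  obtain ⟨r, rfl⟩ := Ideal.Quotient.mk_surjective x
  rw [Algebra.smul_def, Ideal.Quotient.algebraMap_eq, Ideal.Quotient.eq_zero_iff_mem.2 ha,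
    zero_mul]

theorem IsGVTorsionFree.linearMap_eq_zero {M : Type u} [AddCommGroup M] [Module R M]
    (hM : IsGVTorsionFree R M) {J : Ideal R} (hJ : IsGVIdeal J) (f : (R ⧸ J) →ₗ[R] M) :
    f = 0 :=
  LinearMap.ext fun x ↦ isGVTorsionFree_iff.1 hM J hJ _ fun a ha ↦ by
    rw [← map_smul, smul_quotient_eq_zero ha, map_zero]

theorem isGVTorsion_quotient {J : Ideal R} (hJ : IsGVIdeal J) : IsGVTorsion R (R ⧸ J) :=
  Set.eq_univ_of_forall fun x ↦ ⟨J, hJ, fun _ ha ↦ smul_quotient_eq_zero ha x⟩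

theorem isWModule_self : IsWModule R R :=
  ⟨isGVTorsionFree_self, fun _ hJ ↦ hJ.ext_one⟩

theorem IsWModule.pi {M : Type u} [AddCommGroup M] [Module R M] (hM : IsWModule R M) (n : ℕ) :
    IsWModule R (Fin n → M) :=
  ⟨hM.torsionFree.pi n, fun J hJ ↦ (hM.ext_one J hJ).pi n⟩

/-- `Ext^1(R/J, ker f)` sits between `Hom(R/J, N)` and `Ext^1(R/J, M)`, so `N` need only be
GV-torsion-free. -/
theorem IsWModule.ker {M N : Type u} [AddCommGroup M] [Module R M] [AddCommGroup N] [Module R N]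
    (hM : IsWModule R M) (hN : IsGVTorsionFree R N) {f : M →ₗ[R] N}
    (hf : Function.Surjective f) : IsWModule R (LinearMap.ker f) where
  torsionFree := hM.torsionFree.of_injective _ (LinearMap.ker f).injective_subtype
  ext_one J hJ := subsingleton_ext_X₁ (LinearMap.shortExact_shortComplexKer hf) (zero_add 1)
    (extVanishes_zero_of_linearMap_eq_zero fun g ↦ hN.linearMap_eq_zero hJ g) (hM.ext_one J hJ)

theorem IsGVIdeal.eq_top_of_extVanishes {J : Ideal R} (hJ : IsGVIdeal J)
    (h : ExtVanishes R 1 (R ⧸ J) J) : J = ⊤ := by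
  let S : ShortComplex (ModuleCat.{u} R) :=
    ModuleCat.shortComplexOfCompEqZero J.subtype J.mkQ (LinearMap.exact_subtype_mkQ J).linearMap_comp_eq_zero
  have hS : S.ShortExact := ModuleCat.shortComplex_shortExact S
    (LinearMap.exact_subtype_mkQ J) J.injective_subtype J.mkQ_surjective
  -- `Hom(R/J, R/J)` sits between `Hom(R/J, R)` and `Ext^1(R/J, J)`, both zero.
  have hsub : Subsingleton (Ext (ModuleCat.of R (R ⧸ J)) (ModuleCat.of R (R ⧸ J)) 0) :=
    subsingleton_ext_X₃ hS (zero_add 1)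
      (extVanishes_zero_of_linearMap_eq_zero hJ.hom_eq_zero) h
  have hid : 𝟙 (ModuleCat.of R (R ⧸ J)) = 0 :=
    (Ext.mk₀_bijective _ _).1 (Subsingleton.elim _ _)
  have hone : (1 : R ⧸ J) = 0 := LinearMap.congr_fun (congrArg ModuleCat.Hom.hom hid) 1
  rwa [Ideal.eq_top_iff_one, ← Ideal.Quotient.eq_zero_iff_mem, map_one]

theorem IsGVIdeal.eq_top {J : Ideal R} (hJ : IsGVIdeal J)
    (h : ∀ (M : Type u) [AddCommGroup M] [Module R M], IsWModule R M → IsStrongWModule R M) :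
    J = ⊤ := by
  have : Module.Finite R J := Module.Finite.iff_fg.2 hJ.fg
  obtain ⟨n, f, hf⟩ := Module.Finite.exists_fin' R J
  have hker : IsStrongWModule R (LinearMap.ker f) :=
    h _ ((isWModule_self.pi n).ker
      (isGVTorsionFree_self.of_injective J.subtype J.injective_subtype) hf)
  -- `Ext^1(R/J, J)` sits between `Ext^1(R/J, R^n)` and `Ext^2(R/J, ker f)`.
  exact hJ.eq_top_of_extVanishes <| subsingleton_ext_X₃
    (LinearMap.shortExact_shortComplexKer hf) (one_add_one_eq_two)
    ((isWModule_self.pi n).ext_one J hJ)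
    (hker.ext_ge_two 2 le_rfl (R ⧸ J) (isGVTorsion_quotient hJ))

theorem IsGVTorsion.subsingleton (hR : IsDWRing R) {T : Type u} [AddCommGroup T] [Module R T]
    (hT : IsGVTorsion R T) : Subsingleton T := by
  refine subsingleton_of_forall_eq 0 fun x ↦ ?_
  obtain ⟨J, hJ, hx⟩ : x ∈ gvTorsion R T := hT ▸ Set.mem_univ x
  rw [hR] at hJ
  obtain rfl : J = ⊤ := hJ
  simpa using hx 1 Submodule.mem_top

end GV

end

theorem mainTheorem7 (R : Type u) [CommRing R] :
    (∀ (M : Type u) [AddCommGroup M] [Module R M],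
      GV.IsWModule R M → GV.IsStrongWModule R M) ↔ GV.IsDWRing R := by
  constructor
  · intro h
    exact Set.eq_singleton_iff_unique_mem.2 ⟨GV.isGVIdeal_top, fun J hJ ↦ hJ.eq_top h⟩
  · intro hR M _ _ hM
    refine { hM with ext_ge_two := fun i _ T _ _ hT ↦ ?_ }
    have := hT.subsingleton hR
    exact GV.extVanishes_of_subsingleton_left i T M
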